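/- Vectors are considered up to normalization, and a state of $\mathbb{C}^a\otimes\mathbb{C}^b\otimes\mathbb{C}^c$ is a nonzero vector. A state $\psi\in\mathbb{C}^a\otimes\mathbb{C}^b\otimes\mathbb{C}^c$ can be (probabilistically) transformed into a state $\phi\in\mathbb{C}^{a'}\otimes\mathbb{C}^{b'}\otimes\mathbb{C}^{c'}$ if $(A\otimes B\otimes C)\psi=\phi$ for some complex matrices $A,B,C$ of sizes $a'\times a$, $b'\times b$, $c'\times c$, not necessarily invertible. An $a\times b\times c$ state is a state of $\mathbb{C}^a\otimes\mathbb{C}^b\otimes\mathbb{C}^c$ whose three one-party reduced density matrices have ranks $a$, $b$, $c$. A common resource for a set $\mathcal{S}$ of states is a state that can be transformed into every element of $\mathcal{S}$. A common resource $\psi$ for $\mathcal{S}$ is optimal if for every other common resource $\phi$ for $\mathcal{S}$ (of any local dimensions), either $\phi$ can be transformed into $\psi$, or neither of $\phi$, $\psi$ can be transformed into the other. The state corresponding to the pencil $\mu R+\lambda S$, with $R,S$ complex $m\times n$ matrices, is $\sum_{j,k}\left(R_{jk}|0\rangle|j\rangle|k\rangle+S_{jk}|1\rangle|j\rangle|k\rangle\right)$.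 Theorem. Let $m\ge 4$, and let $\psi_m\in\mathbb{C}^2\otimes\mathbb{C}^m\otimes\mathbb{C}^{2m-2}$ be the state corresponding to the block-diagonal $m\times(2m-2)$ pencil $(m-3)L_1\oplus L_2\oplus M^1(0)$, where $$L_1=\begin{pmatrix}\lambda&\mu\end{pmatrix},\qquad L_2=\begin{pmatrix}\lambda&\mu&0\\0&\lambda&\mu\end{pmatrix},\qquad M^1(0)=\begin{pmatrix}\lambda\end{pmatrix}.$$ Then $\psi_m$ is an optimal common resource for the set of all $2\times m\times m$ states. Moreover, no state in $\mathbb{C}^2\otimes\mathbb{C}^m\otimes\mathbb{C}^{2m-3}$, or in any lower dimensions $\mathbb{C}^a\otimes\mathbb{C}^b\otimes\mathbb{C}^c$ with $a\le 2$, $b\le m$, $c\le 2m-3$, is a common resource for the set of all $2\times m\times m$ states. -/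

import Mathlib

open scoped Kronecker Matrix

/-- Vectors of `ℂ^a ⊗ ℂ^b ⊗ ℂ^c`, given by their coefficients in the computational (product) basis:
`ψ ((i, j), k)` is the coefficient of `|i⟩_A |j⟩_B |k⟩_C`.
States are nonzero such vectors; normalization is ignored. -/
abbrev TripartiteVec (a b c : ℕ) : Type := (Fin a × Fin b) × Fin c → ℂ

/-- `ψ` can be transformed probabilistically (by SLOCC) into `φ`: there are local operators
`A`, `B`, `C`, not necessarily invertible or square, with `(A ⊗ B ⊗ C) ψ = φ`. -/
def SLOCCTransformable {a b c a' b' c' : ℕ}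
    (ψ : TripartiteVec a b c) (φ : TripartiteVec a' b' c') : Prop :=
  ∃ (A : Matrix (Fin a') (Fin a) ℂ) (B : Matrix (Fin b') (Fin b) ℂ)
    (C : Matrix (Fin c') (Fin c) ℂ), ((A ⊗ₖ B) ⊗ₖ C) *ᵥ ψ = φ

/-- The (unnormalized) reduced density matrix of the first party. -/
noncomputable def reducedDensityA {a b c : ℕ} (ψ : TripartiteVec a b c) :
    Matrix (Fin a) (Fin a) ℂ :=
  Matrix.of fun i i' => ∑ j, ∑ k, ψ ((i, j), k) * star (ψ ((i', j), k))

/-- The (unnormalized) reduced density matrix of the second party. -/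
noncomputable def reducedDensityB {a b c : ℕ} (ψ : TripartiteVec a b c) :
    Matrix (Fin b) (Fin b) ℂ :=
  Matrix.of fun j j' => ∑ i, ∑ k, ψ ((i, j), k) * star (ψ ((i, j'), k))

/-- The (unnormalized) reduced density matrix of the third party. -/
noncomputable def reducedDensityC {a b c : ℕ} (ψ : TripartiteVec a b c) :
    Matrix (Fin c) (Fin c) ℂ :=
  Matrix.of fun k k' => ∑ i, ∑ j, ψ ((i, j), k) * star (ψ ((i, j), k'))

/-- The `a × b × c` states: the states of `ℂ^a ⊗ ℂ^b ⊗ ℂ^c` that are truly entangled in all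
dimensions, i.e. whose three reduced density matrices have ranks `a`, `b` and `c`. -/
def trulyEntangledStates (a b c : ℕ) : Set (TripartiteVec a b c) :=
  {ψ | ψ ≠ 0 ∧ (reducedDensityA ψ).rank = a ∧ (reducedDensityB ψ).rank = b ∧
    (reducedDensityC ψ).rank = c}

/-- `ψ` is a common resource state for the set `S`. -/
def IsCommonResource {a b c a' b' c' : ℕ}
    (ψ : TripartiteVec a b c) (S : Set (TripartiteVec a' b' c')) : Prop :=
  ψ ≠ 0 ∧ ∀ φ ∈ S, SLOCCTransformable ψ φ

/-- `ψ` is an optimal common resource state for `S`: it is a common resource state, and every common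
resource state `φ` for `S`, of whatever local dimensions, either can be transformed into `ψ`, or
neither of the two can be transformed into the other. (For `φ = ψ` the condition is trivial.) -/
def IsOptimalCommonResource {a b c a' b' c' : ℕ}
    (ψ : TripartiteVec a b c) (S : Set (TripartiteVec a' b' c')) : Prop :=
  IsCommonResource ψ S ∧
    ∀ (p q r : ℕ) (φ : TripartiteVec p q r), IsCommonResource φ S →
      SLOCCTransformable φ ψ ∨ (¬ SLOCCTransformable φ ψ ∧ ¬ SLOCCTransformable ψ φ)

/-- The state `|0⟩ |R⟩ + |1⟩ |S⟩` corresponding to the matrix pencil `μ R + λ S`. -/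
def pencilState {m n : ℕ} (R S : Matrix (Fin m) (Fin n) ℂ) : TripartiteVec 2 m n :=
  fun x => if x.1.1 = 0 then R x.1.2 x.2 else S x.1.2 x.2

/-- The coefficient matrix of `μ` in the `m × (2m-2)` pencil
`(m-3) L₁ ⊕ L₂ ⊕ M¹(0)` (for `3 ≤ m`), where `L_ε` is the `ε × (ε+1)` pencil with `λ` on the diagonal
and `μ` directly to its right, and `M¹(0) = (λ)`. Rows and columns are counted from `0`:
rows `0, …, m-4` are the `L₁` blocks, rows `m-3` and `m-2` the block `L₂`, and row `m-1` the block
`M¹(0)`. -/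
def resourceR (m : ℕ) : Matrix (Fin m) (Fin (2 * m - 2)) ℂ :=
  Matrix.of fun i j =>
    if ((i : ℕ) + 3 ≤ m ∧ (j : ℕ) = 2 * i + 1) ∨ ((i : ℕ) + 2 = m ∧ (j : ℕ) = 2 * i) then 1 else 0

/-- The coefficient matrix of `λ` in the `m × (2m-2)` pencil `(m-3) L₁ ⊕ L₂ ⊕ M¹(0)`. -/
def resourceS (m : ℕ) : Matrix (Fin m) (Fin (2 * m - 2)) ℂ :=
  Matrix.of fun i j =>
    if ((i : ℕ) + 3 ≤ m ∧ (j : ℕ) = 2 * i) ∨ (m < (i : ℕ) + 3 ∧ (j : ℕ) + 1 = 2 * i) then 1 else 0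

/-- The `2 × m × (2m-2)` state corresponding to the pencil `(m-3) L₁ ⊕ L₂ ⊕ M¹(0)`. -/
def resourceState (m : ℕ) : TripartiteVec 2 m (2 * m - 2) :=
  pencilState (resourceR m) (resourceS m)

/-! Stack the `μ`-rows and the `λ`-rows of a pencil with `m` rows into `2m` vectors. The linear
relations among them decide what the third party can reach. For the resource, all relations follow
from two: the last `μ`-row is zero, and the `μ`-row of index `m - 3` equals the `λ`-row of index `m
- 2`. The third party alone can therefore reach exactly the pencils satisfying both.

Every `2 × m × m` pencil satisfies them after invertible changes by the first two parties. What is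
needed is a basis `R'`, `S'` of the pencil and independent `u`, `v`, `w` with `w R' = 0` and `u R' +
v S' = 0`. `exists_combinations_linearIndependent_triple` finds these from a singular member, which
exists over an algebraically closed field, and from the relation space, whose dimension is at least
`m ≥ 4`.

Conversely, a common resource in `2 × m × r` has at most two independent relations
(`IsCommonResource.le_rank_flattenC`). Reaching `splitState` forces all relations, up to one
dimension, to be left null vectors of a single member; reaching `distinctState` gives every nonzero
member corank at most one. Hence the rank across `AB | C` is at least `2m - 2`.

This bound excludes smaller dimensions. It also gives optimality: if the resource is transformed
into another common resource, no local operator can have lost anything, so the transformation can be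
undone. -/

/-! ### Linear relations in a pencil of endomorphisms -/

/-- Two linear maps whose values are linearly dependent at every point are linearly dependent, unless
both take values in a common line. -/
theorem LinearMap.exists_combination_eq_zero_or_le_span_singleton {K V Q : Type*} [Field K]
    [AddCommGroup V] [Module K V] [AddCommGroup Q] [Module K Q] (X Y : V →ₗ[K] Q)
    (h : ∀ k, ¬ LinearIndependent K ![X k, Y k]) :
    (∃ a b : K, (a ≠ 0 ∨ b ≠ 0) ∧ ∀ k, a • X k + b • Y k = 0) ∨
      ∃ z : Q, ∀ k, X k ∈ Submodule.span K {z} ∧ Y k ∈ Submodule.span K {z} := by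
  by_cases hX : ∀ k, X k = 0
  · exact Or.inl ⟨1, 0, by simp, fun k => by simp [hX k]⟩
  push Not at hX
  obtain ⟨k₁, hk₁⟩ := hX
  have dep : ∀ k, X k ≠ 0 → ∃ t : K, t • X k = Y k := by
    intro k hk
    have := h k
    rw [LinearIndependent.pair_iff' hk] at this
    push Not at this
    exact this
  obtain ⟨t, ht⟩ := dep k₁ hk₁
  -- `Y - t • X` vanishes at `k₁`; where it does not vanish, `X` is a multiple of it.
  have dep' : ∀ k, Y k - t • X k ≠ 0 → ∃ s : K, s • (Y k - t • X k) = X k := by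
    intro k hk
    by_cases hXk : X k = 0
    · exact ⟨0, by simp [hXk]⟩
    obtain ⟨r, hr⟩ := dep k hXk
    have hrt : r - t ≠ 0 := by
      intro h0
      rw [← hr, ← sub_smul, h0, zero_smul] at hk
      exact hk rfl
    refine ⟨(r - t)⁻¹, ?_⟩
    rw [← hr, ← sub_smul, smul_smul, inv_mul_cancel₀ hrt, one_smul]
  by_cases hZ : ∀ k, Y k - t • X k = 0
  · exact Or.inl ⟨-t, 1, by simp, fun k => by rw [← hZ k]; module⟩
  push Not at hZ
  obtain ⟨k₂, hk₂⟩ := hZ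
  have key : ∀ k, Y k - t • X k ≠ 0 →
      X k ∈ Submodule.span K {X k₁} ∧ Y k ∈ Submodule.span K {X k₁} := by
    intro k hk
    obtain ⟨s, hs⟩ := dep' k hk
    -- Passing from `k` to `k + k₁` fixes `Y - t • X` but shifts `X` by `X k₁`, so `X k₁` is itself
    -- a multiple of that fixed vector.
    have e : Y (k + k₁) - t • X (k + k₁) = Y k - t • X k := by
      rw [map_add, map_add, ← ht]; module
    obtain ⟨s', hs'⟩ := dep' (k + k₁) (by rwa [e])
    rw [e, map_add] at hs'
    have h1 : (s' - s) • (Y k - t • X k) = X k₁ := by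
      rw [sub_smul, hs', hs]; abel
    have hne : s' - s ≠ 0 := by
      intro h0
      rw [h0, zero_smul] at h1
      exact hk₁ h1.symm
    have hY : Y k - t • X k ∈ Submodule.span K {X k₁} := by
      rw [Submodule.mem_span_singleton]
      exact ⟨(s' - s)⁻¹, by rw [← h1, smul_smul, inv_mul_cancel₀ hne, one_smul]⟩
    have hXk : X k ∈ Submodule.span K {X k₁} := hs ▸ Submodule.smul_mem _ _ hY
    exact ⟨hXk, by simpa using Submodule.add_mem _ hY (Submodule.smul_mem _ t hXk)⟩
  refine Or.inr ⟨X k₁, fun k => ?_⟩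
  by_cases hk : Y k - t • X k = 0
  -- Where `Y - t • X` vanishes, write `k` as `(k + k₂) - k₂`; `key` applies to both terms.
  · have e : Y (k + k₂) - t • X (k + k₂) = Y k₂ - t • X k₂ := by
      rw [map_add, map_add, ← add_zero (Y k₂ - t • X k₂), ← hk]; module
    have h2 := key (k + k₂) (by rwa [e])
    have h3 := key k₂ hk₂
    rw [map_add, map_add] at h2
    exact ⟨(Submodule.add_mem_iff_left _ h3.1).1 h2.1, (Submodule.add_mem_iff_left _ h3.2).1 h2.2⟩
  · exact key k hk

section

variable {K E : Type*} [Field K] [AddCommGroup E] [Module K E] [FiniteDimensional K E]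

theorem finrank_le_finrank_ker_coprod (f g : E →ₗ[K] E) :
    Module.finrank K E ≤ Module.finrank K (LinearMap.ker (f.coprod g)) := by
  have h1 := LinearMap.finrank_range_add_finrank_ker (f.coprod g)
  have h2 := Submodule.finrank_le (LinearMap.range (f.coprod g))
  rw [Module.finrank_prod] at h1
  omega

theorem exists_linearIndependent_triple_of_two_le_finrank_ker (f g : E →ₗ[K] E) (hf : f ≠ 0)
    (hker : ∀ x, f x = 0 → g x = 0 → x = 0)
    (hd : 2 ≤ Module.finrank K (LinearMap.ker f)) :
    ∃ u v w, LinearIndependent K ![u, v, w] ∧ f w = 0 ∧ f u + g v = 0 := by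
  -- If every relation had `y = 0`, the relation space would embed in `ker f`, forcing `f = 0` by
  -- dimension.
  obtain ⟨x, y, hxy, hy⟩ : ∃ x y, f x + g y = 0 ∧ y ≠ 0 := by
    by_contra hcon
    push Not at hcon
    apply hf
    rw [← LinearMap.ker_eq_top]
    apply Submodule.eq_top_of_finrank_eq
    apply le_antisymm (Submodule.finrank_le _)
    refine (finrank_le_finrank_ker_coprod f g).trans ?_
    have hy0 : ∀ k : LinearMap.ker (f.coprod g), k.1.2 = 0 := fun k =>
      hcon k.1.1 k.1.2 (LinearMap.mem_ker.1 k.2)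
    let φ : LinearMap.ker (f.coprod g) →ₗ[K] LinearMap.ker f :=
      LinearMap.codRestrict _ (LinearMap.fst K E E ∘ₗ Submodule.subtype _) (fun k => by
        have := k.2
        rw [LinearMap.mem_ker, LinearMap.coprod_apply, hy0 k] at this
        simpa using this)
    apply LinearMap.finrank_le_finrank_of_injective (f := φ)
    intro k k' hkk
    apply Subtype.ext
    apply Prod.ext
    · exact congrArg Subtype.val hkk
    · rw [hy0, hy0]
  obtain ⟨w, hw, hwy⟩ : ∃ w ∈ LinearMap.ker f, w ∉ Submodule.span K {y} := by
    by_contra hcon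
    push Not at hcon
    have h1 := Submodule.finrank_mono (show LinearMap.ker f ≤ Submodule.span K {y} from hcon)
    rw [finrank_span_singleton hy] at h1
    omega
  have hyw : LinearIndependent K ![y, w] := by
    rw [LinearIndependent.pair_iff' hy]
    exact fun a ha => hwy (Submodule.mem_span_singleton.2 ⟨a, ha⟩)
  -- The relation survives adding an element of `ker f` to `x`. If this never left the span of `y`
  -- and `w`, that span would be `ker f`, so `f y = g y = 0`.
  obtain ⟨n, hn, hnx⟩ : ∃ n ∈ LinearMap.ker f, x + n ∉ Submodule.span K (Set.range ![y, w]) := by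
    by_contra hcon
    push Not at hcon
    have hx : x ∈ Submodule.span K (Set.range ![y, w]) := by simpa using hcon 0 (Submodule.zero_mem _)
    have hle : LinearMap.ker f ≤ Submodule.span K (Set.range ![y, w]) := fun n hn =>
      (Submodule.add_mem_iff_right _ hx).1 (hcon n hn)
    have heq := Submodule.eq_of_le_of_finrank_le hle (by
      rw [finrank_span_eq_card hyw]; simpa using hd)
    have hfx : f x = 0 := LinearMap.mem_ker.1 (heq ▸ hx)
    have hfy : f y = 0 := LinearMap.mem_ker.1 (heq ▸ Submodule.subset_span ⟨0, rfl⟩)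
    rw [hfx, zero_add] at hxy
    exact hy (hker y hfy hxy)
  refine ⟨x + n, y, w, ?_, LinearMap.mem_ker.1 hw, ?_⟩
  · exact linearIndependent_finCons.2 ⟨hyw, hnx⟩
  · rw [map_add, LinearMap.mem_ker.1 hn, add_zero, hxy]

/-- The two components of a relation are read modulo `w`. If they are always dependent, either one
fixed combination of them vanishes, which yields a large kernel, or all components lie in one plane,
which leaves too little room for the relations. -/
theorem exists_linearIndependent_triple_or_two_le_finrank_ker (f g : E →ₗ[K] E)
    (hE : 4 ≤ Module.finrank K E) (hker : ∀ x, f x = 0 → g x = 0 → x = 0)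
    (w : E) (hw : w ≠ 0) (hfw : f w = 0) :
    (∃ u v, LinearIndependent K ![u, v, w] ∧ f u + g v = 0) ∨
      ∃ a b : K, (a ≠ 0 ∨ b ≠ 0) ∧ 2 ≤ Module.finrank K (LinearMap.ker (a • f + b • g)) := by
  by_cases hdone : ∃ u v, LinearIndependent K ![u, v, w] ∧ f u + g v = 0
  · exact Or.inl hdone
  right
  push Not at hdone
  set W := LinearMap.ker (f.coprod g)
  have hdim : Module.finrank K E ≤ Module.finrank K W := finrank_le_finrank_ker_coprod f g
  have hmem : ∀ k : W, f k.1.1 + g k.1.2 = 0 := fun k => LinearMap.mem_ker.1 k.2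
  let X : W →ₗ[K] E ⧸ Submodule.span K {w} := Submodule.mkQ _ ∘ₗ LinearMap.fst K E E ∘ₗ W.subtype
  let Y : W →ₗ[K] E ⧸ Submodule.span K {w} := Submodule.mkQ _ ∘ₗ LinearMap.snd K E E ∘ₗ W.subtype
  have hXY : ∀ k, ¬ LinearIndependent K ![X k, Y k] := by
    intro k hli
    refine hdone k.1.1 k.1.2 ?_ (hmem k)
    rw [LinearIndependent.pair_iff] at hli
    rw [Fintype.linearIndependent_iff]
    intro c hc
    simp only [Fin.sum_univ_three, Matrix.cons_val_zero, Matrix.cons_val_one, Matrix.cons_val] at hc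
    have h0 := hli (c 0) (c 1) (by
      change c 0 • Submodule.Quotient.mk k.1.1 + c 1 • Submodule.Quotient.mk k.1.2 = 0
      rw [← Submodule.Quotient.mk_smul, ← Submodule.Quotient.mk_smul, ← Submodule.Quotient.mk_add,
        Submodule.Quotient.mk_eq_zero, Submodule.mem_span_singleton]
      exact ⟨-c 2, by rw [neg_smul, neg_eq_iff_add_eq_zero, add_comm]; exact hc⟩)
    rw [h0.1, h0.2, zero_smul, zero_smul, zero_add, zero_add, smul_eq_zero] at hc
    intro i
    fin_cases i
    · exact h0.1
    · exact h0.2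
    · exact hc.resolve_right hw
  rcases LinearMap.exists_combination_eq_zero_or_le_span_singleton X Y hXY with
    ⟨a, b, hab, h⟩ | ⟨z, h⟩
  · let θ : W →ₗ[K] E := (a • LinearMap.fst K E E + b • LinearMap.snd K E E) ∘ₗ W.subtype
    have hr : Module.finrank K (LinearMap.range θ) ≤ 1 := by
      rw [← finrank_span_singleton (K := K) hw]
      apply Submodule.finrank_mono
      rintro _ ⟨k, rfl⟩
      rw [← Submodule.Quotient.mk_eq_zero]
      exact h k
    have hrn := LinearMap.finrank_range_add_finrank_ker θ
    obtain ⟨c, d, hcd⟩ : ∃ c d : K, c * b - d * a = 1 := by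
      rcases hab with ha | hb
      · exact ⟨0, -a⁻¹, by field_simp; ring⟩
      · exact ⟨b⁻¹, 0, by field_simp; ring⟩
    -- On `ker θ` a relation has the form `(b • z, -a • z)`, so `z` is killed by `b • f - a • g`;
    -- `c` and `d` recover `z`. Since `θ` has rank at most one, `ker θ` has dimension at least
    -- three.
    refine ⟨b, -a, by simpa [or_comm] using hab, ?_⟩
    let ζ : LinearMap.ker θ →ₗ[K] LinearMap.ker (b • f + (-a) • g) :=
      LinearMap.codRestrict _
        ((c • LinearMap.fst K E E + d • LinearMap.snd K E E) ∘ₗ W.subtype ∘ₗ Submodule.subtype _)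
        (fun k => by
          have h1 : a • k.1.1.1 + b • k.1.1.2 = 0 := k.2
          have h2 := hmem k.1
          have h3 : b • (c • k.1.1.1 + d • k.1.1.2) = k.1.1.1 := by
            calc _ = (c * b - d * a) • k.1.1.1 + d • (a • k.1.1.1 + b • k.1.1.2) := by module
              _ = _ := by rw [h1, hcd]; simp
          have h4 : (-a) • (c • k.1.1.1 + d • k.1.1.2) = k.1.1.2 := by
            calc _ = (c * b - d * a) • k.1.1.2 - c • (a • k.1.1.1 + b • k.1.1.2) := by module
              _ = _ := by rw [h1, hcd]; simp
          change b • f (c • k.1.1.1 + d • k.1.1.2) + (-a) • g (c • k.1.1.1 + d • k.1.1.2) = 0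
          rw [← map_smul, ← map_smul, h3, h4, h2])
    have hζ : Function.Injective ζ := by
      rw [injective_iff_map_eq_zero]
      intro k hk
      have h1 : a • k.1.1.1 + b • k.1.1.2 = 0 := k.2
      have h2 : c • k.1.1.1 + d • k.1.1.2 = 0 := congrArg Subtype.val hk
      apply Subtype.ext
      apply Subtype.ext
      apply Prod.ext
      · calc k.1.1.1 = (c * b - d * a) • k.1.1.1 := by rw [hcd, one_smul]
          _ = b • (c • k.1.1.1 + d • k.1.1.2) - d • (a • k.1.1.1 + b • k.1.1.2) := by module
          _ = 0 := by rw [h1, h2]; simp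
      · calc k.1.1.2 = (c * b - d * a) • k.1.1.2 := by rw [hcd, one_smul]
          _ = c • (a • k.1.1.1 + b • k.1.1.2) - a • (c • k.1.1.1 + d • k.1.1.2) := by module
          _ = 0 := by rw [h1, h2]; simp
    have := LinearMap.finrank_le_finrank_of_injective hζ
    omega
  · exfalso
    obtain ⟨z, rfl⟩ := Submodule.Quotient.mk_surjective _ z
    set D := Submodule.span K (Set.range ![z, w])
    have hwD : w ∈ D := Submodule.subset_span ⟨1, rfl⟩
    have hzD : z ∈ D := Submodule.subset_span ⟨0, rfl⟩
    have hDfin : Module.finrank K D ≤ 2 := by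
      exact finrank_range_le_card (R := K) ![z, w]
    have lift : ∀ x : E, (Submodule.Quotient.mk x : E ⧸ Submodule.span K {w}) ∈
        Submodule.span K {(Submodule.Quotient.mk z : E ⧸ Submodule.span K {w})} → x ∈ D := by
      intro x hx
      obtain ⟨t, ht⟩ := Submodule.mem_span_singleton.1 hx
      rw [← Submodule.Quotient.mk_smul, Submodule.Quotient.eq] at ht
      obtain ⟨s, hs⟩ := Submodule.mem_span_singleton.1 ht
      have : x = t • z - s • w := by rw [hs]; abel
      rw [this]
      exact D.sub_mem (D.smul_mem _ hzD) (D.smul_mem _ hwD)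
    -- The inclusion is strict because `(0, w)` is not a relation. Thus `W` has dimension below
    -- four, which is where the bound `4 ≤ finrank K E` enters.
    have hlt : W < D.prod D := by
      refine lt_of_le_of_ne (fun k hk => ⟨lift _ (h ⟨k, hk⟩).1, lift _ (h ⟨k, hk⟩).2⟩) fun heq => ?_
      have : ((0 : E), w) ∈ W := heq ▸ ⟨D.zero_mem, hwD⟩
      have := hmem ⟨_, this⟩
      simp only [map_zero, zero_add] at this
      exact hw (hker w hfw this)
    have h1 := Submodule.finrank_lt_finrank_of_lt hlt
    have h2 := LinearMap.finrank_range_le (LinearMap.prodMap D.subtype D.subtype)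
    rw [LinearMap.range_prodMap, Submodule.range_subtype, Module.finrank_prod] at h2
    omega

theorem exists_combination_ker_ne_bot [IsAlgClosed K] [Nontrivial E] (f g : E →ₗ[K] E) :
    ∃ p q : K, (p ≠ 0 ∨ q ≠ 0) ∧ ∃ w ≠ 0, (p • f + q • g) w = 0 := by
  by_cases hg : ∃ w ≠ 0, g w = 0
  · obtain ⟨w, hw, h⟩ := hg
    exact ⟨0, 1, by simp, w, hw, by simp [h]⟩
  push Not at hg
  have hinj : Function.Injective g := by
    rw [← LinearMap.ker_eq_bot, LinearMap.ker_eq_bot']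
    exact fun x hx => by_contra fun h0 => hg x h0 hx
  let e := LinearEquiv.ofInjectiveEndo g hinj
  obtain ⟨t, ht⟩ := Module.End.exists_eigenvalue (K := K) ((e.symm : E →ₗ[K] E) ∘ₗ f)
  obtain ⟨w, hw⟩ := ht.exists_hasEigenvector
  refine ⟨1, -t, by simp, w, hw.2, ?_⟩
  have h1 : e.symm (f w) = t • w := hw.apply_eq_smul
  rw [LinearEquiv.symm_apply_eq, map_smul] at h1
  have h2 : e w = g w := rfl
  simp [h1, h2]

theorem exists_combinations_linearIndependent_triple [IsAlgClosed K] (f g : E →ₗ[K] E)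
    (hE : 4 ≤ Module.finrank K E) (hker : ∀ x, f x = 0 → g x = 0 → x = 0)
    (hfg : ∀ a b : K, a • f + b • g = 0 → a = 0 ∧ b = 0) :
    ∃ p q r s : K, p * s - q * r ≠ 0 ∧ ∃ u v w, LinearIndependent K ![u, v, w] ∧
      (p • f + q • g) w = 0 ∧ (p • f + q • g) u + (r • f + s • g) v = 0 := by
  have compl : ∀ p q : K, p ≠ 0 ∨ q ≠ 0 → ∃ r s : K, p * s - q * r ≠ 0 := by
    rintro p q (h | h)
    · exact ⟨0, 1, by simpa⟩
    · exact ⟨1, 0, by simpa⟩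
  have hker' : ∀ p q r s : K, p * s - q * r ≠ 0 → ∀ x, (p • f + q • g) x = 0 →
      (r • f + s • g) x = 0 → x = 0 := by
    intro p q r s hd x h1 h2
    simp only [LinearMap.add_apply, LinearMap.smul_apply] at h1 h2
    apply hker
    · have : (p * s - q * r) • f x = 0 := by
        calc _ = s • (p • f x + q • g x) - q • (r • f x + s • g x) := by module
          _ = 0 := by rw [h1, h2]; simp
      exact (smul_eq_zero.1 this).resolve_left hd
    · have : (p * s - q * r) • g x = 0 := by
        calc _ = p • (r • f x + s • g x) - r • (p • f x + q • g x) := by module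
          _ = 0 := by rw [h1, h2]; simp
      exact (smul_eq_zero.1 this).resolve_left hd
  have big : ∀ p q : K, p ≠ 0 ∨ q ≠ 0 → 2 ≤ Module.finrank K (LinearMap.ker (p • f + q • g)) →
      ∃ p q r s : K, p * s - q * r ≠ 0 ∧ ∃ u v w, LinearIndependent K ![u, v, w] ∧
        (p • f + q • g) w = 0 ∧ (p • f + q • g) u + (r • f + s • g) v = 0 := by
    intro p q hpq h2
    obtain ⟨r, s, hd⟩ := compl p q hpq
    refine ⟨p, q, r, s, hd, exists_linearIndependent_triple_of_two_le_finrank_ker _ _ ?_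
      (hker' p q r s hd) h2⟩
    intro h0
    obtain ⟨rfl, rfl⟩ := hfg p q h0
    simp at hpq
  have : Nontrivial E := Module.nontrivial_of_finrank_pos (R := K) (by omega)
  obtain ⟨p, q, hpq, w, hw, hfw⟩ := exists_combination_ker_ne_bot f g
  obtain ⟨r, s, hd⟩ := compl p q hpq
  rcases exists_linearIndependent_triple_or_two_le_finrank_ker _ _ hE (hker' p q r s hd) w hw hfw with
    ⟨u, v, hli, huv⟩ | ⟨a, b, hab, h2⟩
  · exact ⟨p, q, r, s, hd, u, v, w, hli, hfw, huv⟩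
  · refine big (a * p + b * r) (a * q + b * s) ?_ ?_
    · by_contra hcon
      push Not at hcon
      have ha : a * (p * s - q * r) = 0 := by linear_combination s * hcon.1 - r * hcon.2
      have hb : b * (p * s - q * r) = 0 := by linear_combination p * hcon.2 - q * hcon.1
      simp [hd] at ha hb
      simp [ha, hb] at hab
    · rwa [show (a * p + b * r) • f + (a * q + b * s) • g =
        a • (p • f + q • g) + b • (r • f + s • g) by module]

end

/-! ### Ranks, one-sided inverses and completion to a basis -/

theorem Matrix.rank_eq_iff_vecMul_eq_zero {K ι : Type*} [Field K] [Fintype ι] {a : ℕ}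
    (M : Matrix (Fin a) ι K) : M.rank = a ↔ ∀ v, v ᵥ* M = 0 → v = 0 := by
  rw [Matrix.rank_eq_finrank_span_row]
  have h1 := linearIndependent_iff_card_eq_finrank_span (R := K) (b := M.row)
  rw [Fintype.card_fin] at h1
  rw [eq_comm]
  change a = Set.finrank K (Set.range M.row) ↔ _
  rw [← h1, ← Matrix.vecMul_injective_iff]
  exact injective_iff_map_eq_zero M.vecMulLinear

theorem Matrix.exists_left_inverse_of_rank_eq {K : Type*} [Field K] {m n : ℕ}
    (M : Matrix (Fin m) (Fin n) K) (h : M.rank = n) : ∃ N : Matrix (Fin n) (Fin m) K, N * M = 1 := by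
  rw [← Matrix.vecMul_surjective_iff_exists_left_inverse]
  change Function.Surjective M.vecMulLinear
  rw [← LinearMap.range_eq_top, range_vecMulLinear]
  apply Submodule.eq_top_of_finrank_eq
  rw [← Matrix.rank_eq_finrank_span_row, h, Module.finrank_fin_fun]

theorem Matrix.finrank_ker_vecMulLinear_add_rank {K ι κ : Type*} [Field K] [Fintype ι] [Fintype κ]
    (M : Matrix ι κ K) :
    M.rank + Module.finrank K (LinearMap.ker M.vecMulLinear) = Fintype.card ι := by
  have := LinearMap.finrank_range_add_finrank_ker M.vecMulLinear
  rwa [range_vecMulLinear, ← Matrix.rank_eq_finrank_span_row, Module.finrank_fintype_fun_eq_card]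
    at this

theorem LinearIndependent.exists_isUnit_matrix {K : Type*} [Field K] {n k : ℕ}
    (v : Fin k → Fin (n + k) → K) (hv : LinearIndependent K v) :
    ∃ G : Matrix (Fin (n + k)) (Fin (n + k)) K, IsUnit G ∧ ∀ i, G (Fin.natAdd n i) = v i := by
  let b := Module.Basis.sumExtend hv
  have : Finite (Fin k ⊕ Module.Basis.sumExtendIndex hv) := Module.Finite.finite_basis b
  have : Finite (Module.Basis.sumExtendIndex hv) :=
    Finite.of_injective (Sum.inr (α := Fin k)) Sum.inr_injective
  have := Fintype.ofFinite (Module.Basis.sumExtendIndex hv)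
  have hc := Module.finrank_eq_card_basis b
  rw [Module.finrank_fin_fun, Fintype.card_sum, Fintype.card_fin] at hc
  let e : Module.Basis.sumExtendIndex hv ≃ Fin n := Fintype.equivFinOfCardEq (by omega)
  let E : Fin k ⊕ Module.Basis.sumExtendIndex hv ≃ Fin (n + k) :=
    (Equiv.sumComm _ _).trans ((Equiv.sumCongr e (Equiv.refl _)).trans finSumFinEquiv)
  refine ⟨Matrix.of (b.reindex E), ?_, fun i => ?_⟩
  · rw [← Matrix.linearIndependent_rows_iff_isUnit]
    exact (b.reindex E).linearIndependent
  · change b.reindex E (Fin.natAdd n i) = v i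
    rw [Module.Basis.reindex_apply]
    have : E.symm (Fin.natAdd n i) = Sum.inl i := by
      rw [Equiv.symm_apply_eq]; simp [E]
    rw [this]
    change (Module.Basis.sumExtend hv) (Sum.inl i) = v i
    simp only [Module.Basis.sumExtend, Module.Basis.reindex_apply, Module.Basis.extend_apply_self]
    rfl

/-! ### Slices and flattenings of tripartite vectors -/

namespace TripartiteVec

variable {a b c a' b' c' : ℕ}

/-- The coefficient matrix of `|i⟩_A`. -/
def slice (ψ : TripartiteVec a b c) (i : Fin a) : Matrix (Fin b) (Fin c) ℂ :=
  Matrix.of fun j k => ψ ((i, j), k)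

/-- The coefficient matrix of `ψ` across the bipartition `AB | C`. -/
def flattenC (ψ : TripartiteVec a b c) : Matrix (Fin a × Fin b) (Fin c) ℂ :=
  Matrix.of fun x k => ψ (x, k)

theorem ext_slice {φ ψ : TripartiteVec a b c} (h : ∀ i, slice φ i = slice ψ i) : φ = ψ := by
  funext ⟨⟨i, j⟩, k⟩
  exact congrFun (congrFun (h i) j) k

theorem slice_kronecker_mulVec (A : Matrix (Fin a') (Fin a) ℂ) (B : Matrix (Fin b') (Fin b) ℂ)
    (C : Matrix (Fin c') (Fin c) ℂ) (ψ : TripartiteVec a b c) (i : Fin a') :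
    slice (((A ⊗ₖ B) ⊗ₖ C) *ᵥ ψ) i = B * (∑ l, A i l • slice ψ l) * Cᵀ := by
  ext j k
  simp only [slice, Matrix.of_apply, Matrix.mulVec, dotProduct, Matrix.kroneckerMap_apply,
    Fintype.sum_prod_type, Matrix.mul_apply, Matrix.sum_apply, Matrix.smul_apply,
    Matrix.transpose_apply, smul_eq_mul, Finset.mul_sum, Finset.sum_mul]
  rw [Finset.sum_comm]
  simp_rw [Finset.sum_comm (s := (Finset.univ : Finset (Fin a)))]
  rw [Finset.sum_comm]
  refine Finset.sum_congr rfl fun _ _ => Finset.sum_congr rfl fun _ _ =>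
    Finset.sum_congr rfl fun _ _ => by ring

theorem slice_of_transform {A : Matrix (Fin a') (Fin a) ℂ} {B : Matrix (Fin b') (Fin b) ℂ}
    {C : Matrix (Fin c') (Fin c) ℂ} {ψ : TripartiteVec a b c} {φ : TripartiteVec a' b' c'}
    (h : ((A ⊗ₖ B) ⊗ₖ C) *ᵥ ψ = φ) (i : Fin a') :
    slice φ i = B * (∑ l, A i l • slice ψ l) * Cᵀ := by
  rw [← h, slice_kronecker_mulVec]

theorem combination_of_transform {A : Matrix (Fin a') (Fin a) ℂ} {B : Matrix (Fin b') (Fin b) ℂ}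
    {C : Matrix (Fin c') (Fin c) ℂ} {ψ : TripartiteVec a b c} {φ : TripartiteVec a' b' c'}
    (h : ((A ⊗ₖ B) ⊗ₖ C) *ᵥ ψ = φ) (f : Fin a' → ℂ) :
    ∑ i, f i • slice φ i = B * (∑ l, (f ᵥ* A) l • slice ψ l) * Cᵀ := by
  have hf : ∑ l, (f ᵥ* A) l • slice ψ l = ∑ i, f i • ∑ l, A i l • slice ψ l := by
    simp only [Finset.smul_sum, smul_smul]
    rw [Finset.sum_comm]
    refine Finset.sum_congr rfl fun l _ => ?_
    rw [← Finset.sum_smul]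
    rfl
  rw [hf, Matrix.mul_sum, Matrix.sum_mul]
  refine Finset.sum_congr rfl fun i _ => ?_
  rw [slice_of_transform h, Matrix.mul_smul, Matrix.smul_mul]

theorem flattenC_kronecker_mulVec (A : Matrix (Fin a') (Fin a) ℂ) (B : Matrix (Fin b') (Fin b) ℂ)
    (C : Matrix (Fin c') (Fin c) ℂ) (ψ : TripartiteVec a b c) :
    flattenC (((A ⊗ₖ B) ⊗ₖ C) *ᵥ ψ) = (A ⊗ₖ B) * flattenC ψ * Cᵀ := by
  ext x k
  simp only [flattenC, Matrix.of_apply, Matrix.mulVec, dotProduct, Matrix.mul_apply,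
    Matrix.kroneckerMap_apply, Matrix.transpose_apply]
  rw [Fintype.sum_prod_type, Finset.sum_comm]
  refine Finset.sum_congr rfl fun z _ => ?_
  rw [Finset.sum_mul]
  exact Finset.sum_congr rfl fun y _ => by ring

theorem vecMul_flattenC (ψ : TripartiteVec a b c) (t : Fin a × Fin b → ℂ) :
    t ᵥ* flattenC ψ = ∑ i, (fun j => t (i, j)) ᵥ* slice ψ i := by
  ext k
  simp [Matrix.vecMul, dotProduct, flattenC, slice, Fintype.sum_prod_type]

open scoped ComplexOrder in
-- Each reduced density matrix is `M * Mᴴ` for a flattening `M`, so it has full rank exactly when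
-- the rows of `M` are independent.
theorem mem_trulyEntangledStates_iff (φ : TripartiteVec a b c) :
    φ ∈ trulyEntangledStates a b c ↔ φ ≠ 0 ∧
      (∀ f : Fin a → ℂ, ∑ i, f i • slice φ i = 0 → f = 0) ∧
      (∀ x, (∀ i, x ᵥ* slice φ i = 0) → x = 0) ∧ (∀ z, (∀ i, slice φ i *ᵥ z = 0) → z = 0) := by
  have hA : reducedDensityA φ = (Matrix.of fun i (x : Fin b × Fin c) => φ ((i, x.1), x.2)) *
      (Matrix.of fun i (x : Fin b × Fin c) => φ ((i, x.1), x.2))ᴴ := by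
    ext; simp [reducedDensityA, Matrix.mul_apply, Fintype.sum_prod_type]
  have hB : reducedDensityB φ = (Matrix.of fun j (x : Fin a × Fin c) => φ ((x.1, j), x.2)) *
      (Matrix.of fun j (x : Fin a × Fin c) => φ ((x.1, j), x.2))ᴴ := by
    ext; simp [reducedDensityB, Matrix.mul_apply, Fintype.sum_prod_type]
  have hC : reducedDensityC φ = (Matrix.of fun k (x : Fin a × Fin b) => φ (x, k)) *
      (Matrix.of fun k (x : Fin a × Fin b) => φ (x, k))ᴴ := by
    ext; simp [reducedDensityC, Matrix.mul_apply, Fintype.sum_prod_type]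
  rw [trulyEntangledStates, Set.mem_ofPred_eq, hA, hB, hC]
  rw [Matrix.rank_self_mul_conjTranspose, Matrix.rank_self_mul_conjTranspose,
    Matrix.rank_self_mul_conjTranspose, Matrix.rank_eq_iff_vecMul_eq_zero,
    Matrix.rank_eq_iff_vecMul_eq_zero, Matrix.rank_eq_iff_vecMul_eq_zero]
  refine and_congr Iff.rfl (and_congr ?_ (and_congr ?_ ?_))
  · refine forall_congr' fun f => imp_congr ?_ Iff.rfl
    simp [funext_iff, ← Matrix.ext_iff, Matrix.vecMul, dotProduct, slice, Matrix.sum_apply]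
  · refine forall_congr' fun f => imp_congr ?_ Iff.rfl
    simp [funext_iff, Matrix.vecMul, dotProduct, slice]
  · refine forall_congr' fun f => imp_congr ?_ Iff.rfl
    simp [funext_iff, Matrix.vecMul, Matrix.mulVec, dotProduct, slice, mul_comm]

theorem vecMul_injective_of_transform {A : Matrix (Fin a') (Fin a) ℂ}
    {B : Matrix (Fin b') (Fin b) ℂ} {C : Matrix (Fin c') (Fin c) ℂ} {ψ : TripartiteVec a b c}
    {φ : TripartiteVec a' b' c'} (h : ((A ⊗ₖ B) ⊗ₖ C) *ᵥ ψ = φ)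
    (hφ : φ ∈ trulyEntangledStates a' b' c') :
    Function.Injective A.vecMul ∧ Function.Injective B.vecMul := by
  obtain ⟨-, hA, hB, -⟩ := (mem_trulyEntangledStates_iff φ).1 hφ
  refine ⟨(injective_iff_map_eq_zero A.vecMulLinear).2 fun f hf => hA f ?_,
    (injective_iff_map_eq_zero B.vecMulLinear).2 fun x hx => hB x fun i => ?_⟩
  · rw [combination_of_transform h, show f ᵥ* A = 0 from hf]
    simp
  · rw [slice_of_transform h, ← Matrix.vecMul_vecMul, ← Matrix.vecMul_vecMul,
      show x ᵥ* B = 0 from hx]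
    simp

@[simp] theorem slice_pencilState_zero (R S : Matrix (Fin b) (Fin c) ℂ) :
    slice (pencilState R S) 0 = R := by ext; simp [slice, pencilState]

@[simp] theorem slice_pencilState_one (R S : Matrix (Fin b) (Fin c) ℂ) :
    slice (pencilState R S) 1 = S := by ext; simp [slice, pencilState]

theorem pencilState_diagonal_mem {m : ℕ} (d e : Fin m → ℂ) (h : ∀ i, d i ≠ 0 ∨ e i ≠ 0)
    (hij : ∃ i j, d i * e j - d j * e i ≠ 0) :
    pencilState (Matrix.diagonal d) (Matrix.diagonal e) ∈ trulyEntangledStates 2 m m := by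
  obtain ⟨i, j, hij⟩ := hij
  rw [mem_trulyEntangledStates_iff]
  simp only [Fin.sum_univ_two, Fin.forall_fin_two, slice_pencilState_zero, slice_pencilState_one]
  have aux : ∀ x : Fin m → ℂ, (∀ k, x k * d k = 0) → (∀ k, x k * e k = 0) → x = 0 := by
    intro x h1 h2
    funext k
    rcases h k with hk | hk
    · exact (mul_eq_zero.1 (h1 k)).resolve_right hk
    · exact (mul_eq_zero.1 (h2 k)).resolve_right hk
  refine ⟨fun h0 => ?_, fun f hf => ?_, fun x hx => ?_, fun z hz => ?_⟩
  · have h1 := congrArg (fun φ => slice φ 0 i i) h0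
    have h2 := congrArg (fun φ => slice φ 1 i i) h0
    simp only [slice_pencilState_zero, slice_pencilState_one, Matrix.diagonal_apply_eq] at h1 h2
    rcases h i with hi | hi
    · exact hi h1
    · exact hi h2
  · have h1 := congrFun (congrFun hf i) i
    have h2 := congrFun (congrFun hf j) j
    simp at h1 h2
    have e0 : f 0 * (d i * e j - d j * e i) = 0 := by linear_combination e j * h1 - e i * h2
    have e1 : f 1 * (d i * e j - d j * e i) = 0 := by linear_combination d i * h2 - d j * h1
    funext k
    fin_cases k
    · exact (mul_eq_zero.1 e0).resolve_right hij
    · exact (mul_eq_zero.1 e1).resolve_right hij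
  · apply aux
    · intro k; simpa [Matrix.vecMul_diagonal] using congrFun hx.1 k
    · intro k; simpa [Matrix.vecMul_diagonal] using congrFun hx.2 k
  · apply aux
    · intro k; simpa [Matrix.mulVec_diagonal, mul_comm, or_comm] using congrFun hz.1 k
    · intro k; simpa [Matrix.mulVec_diagonal, mul_comm, or_comm] using congrFun hz.2 k

end TripartiteVec

theorem SLOCCTransformable.trans {a b c a' b' c' a'' b'' c'' : ℕ} {ψ : TripartiteVec a b c}
    {φ : TripartiteVec a' b' c'} {χ : TripartiteVec a'' b'' c''}
    (h : SLOCCTransformable ψ φ) (h' : SLOCCTransformable φ χ) : SLOCCTransformable ψ χ := by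
  obtain ⟨A, B, C, rfl⟩ := h
  obtain ⟨A', B', C', rfl⟩ := h'
  exact ⟨A' * A, B' * B, C' * C, by
    rw [Matrix.mul_kronecker_mul, Matrix.mul_kronecker_mul, Matrix.mulVec_mulVec]⟩

theorem SLOCCTransformable.ne_zero {a b c a' b' c' : ℕ} {ψ : TripartiteVec a b c}
    {φ : TripartiteVec a' b' c'} (h : SLOCCTransformable ψ φ) (hφ : φ ≠ 0) : ψ ≠ 0 := by
  obtain ⟨A, B, C, rfl⟩ := h
  rintro rfl
  exact hφ (Matrix.mulVec_zero _)

open TripartiteVec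

/-! ### Two test states and the lower bound on the third dimension -/

/-- The pencil `diag(λ, μ, …, μ)`. -/
def splitState (m : ℕ) : TripartiteVec 2 m m :=
  pencilState (Matrix.diagonal fun i => if (i : ℕ) = 0 then 0 else 1)
    (Matrix.diagonal fun i => if (i : ℕ) = 0 then 1 else 0)

/-- The pencil `diag(μ, μ + λ, …, μ + (m - 1) λ)`, which has `m` distinct eigenvalues. -/
def distinctState (m : ℕ) : TripartiteVec 2 m m :=
  pencilState (Matrix.diagonal fun _ => 1) (Matrix.diagonal fun i => (i : ℕ))

theorem splitState_mem {m : ℕ} (hm : 2 ≤ m) : splitState m ∈ trulyEntangledStates 2 m m :=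
  pencilState_diagonal_mem _ _ (fun i => by by_cases h : (i : ℕ) = 0 <;> simp [h])
    ⟨⟨0, by omega⟩, ⟨1, by omega⟩, by simp⟩

theorem distinctState_mem {m : ℕ} (hm : 2 ≤ m) : distinctState m ∈ trulyEntangledStates 2 m m :=
  pencilState_diagonal_mem _ _ (fun i => by simp)
    ⟨⟨0, by omega⟩, ⟨1, by omega⟩, by simp⟩

theorem le_rank_combination_distinctState {m : ℕ} (f : Fin 2 → ℂ) (hf : f ≠ 0) :
    m ≤ (∑ i, f i • slice (distinctState m) i).rank + 1 := by
  have h : ∑ i, f i • slice (distinctState m) i =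
      Matrix.diagonal fun i : Fin m => f 0 + f 1 * (i : ℕ) := by
    rw [Fin.sum_univ_two, distinctState, slice_pencilState_zero, slice_pencilState_one,
      ← Matrix.diagonal_smul, ← Matrix.diagonal_smul, Matrix.diagonal_add]
    congr 1
    funext i
    simp
  rw [h]
  classical
  rw [Matrix.rank_diagonal]
  have h1 : Fintype.card {i : Fin m // f 0 + f 1 * ((i : ℕ) : ℂ) = 0} ≤ 1 := by
    rw [Fintype.card_le_one_iff]
    rintro ⟨i, hi⟩ ⟨j, hj⟩
    by_contra hij
    have hij' : ((i : ℕ) : ℂ) - ((j : ℕ) : ℂ) ≠ 0 := by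
      rw [sub_ne_zero]
      intro h
      exact hij (Subtype.ext (Fin.ext (by exact_mod_cast h)))
    have h1 : f 1 * (((i : ℕ) : ℂ) - ((j : ℕ) : ℂ)) = 0 := by linear_combination hi - hj
    have h1 := (mul_eq_zero.1 h1).resolve_right hij'
    rw [h1, zero_mul, add_zero] at hi
    exact hf (funext (Fin.forall_fin_two.2 ⟨hi, h1⟩))
  have h2 := Fintype.card_subtype_compl fun i : Fin m => f 0 + f 1 * ((i : ℕ) : ℂ) = 0
  rw [Fintype.card_fin] at h2
  change m ≤ Fintype.card {i : Fin m // ¬ (f 0 + f 1 * ((i : ℕ) : ℂ) = 0)} + 1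
  omega

/-- A row relation of `χ` survives `Cᵀ`, where the diagonal form kills all but one coefficient on
slice `0`. So, up to one dimension, the relations are left null vectors of slice `1`. -/
theorem rank_slice_one_le_of_splitState {m r : ℕ} (χ : TripartiteVec 2 m r)
    (C : Matrix (Fin m) (Fin r) ℂ) (h : ∀ i, slice (splitState m) i = slice χ i * Cᵀ) :
    (slice χ 1).rank + m ≤ (flattenC χ).rank + 1 := by
  rcases Nat.eq_zero_or_pos m with rfl | hm
  · have := (slice χ 1).rank_le_card_height
    simp at this ⊢
    omega
  have hT := Matrix.finrank_ker_vecMulLinear_add_rank (flattenC χ)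
  have hY := Matrix.finrank_ker_vecMulLinear_add_rank (slice χ 1)
  rw [Fintype.card_prod, Fintype.card_fin, Fintype.card_fin] at hT
  rw [Fintype.card_fin] at hY
  set T := LinearMap.ker (flattenC χ).vecMulLinear
  let ε : T →ₗ[ℂ] ℂ := LinearMap.proj ((0 : Fin 2), (⟨0, hm⟩ : Fin m)) ∘ₗ T.subtype
  have hε := LinearMap.finrank_range_add_finrank_ker ε
  have hε1 : Module.finrank ℂ (LinearMap.range ε) ≤ 1 := by
    simpa using Submodule.finrank_le (LinearMap.range ε)
  have hmem : ∀ t : T, (fun j => t.1 (0, j)) ᵥ* slice χ 0 + (fun j => t.1 (1, j)) ᵥ* slice χ 1 = 0 := by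
    intro t
    have := LinearMap.mem_ker.1 t.2
    rwa [Matrix.vecMulLinear_apply, vecMul_flattenC, Fin.sum_univ_two] at this
  have hzero : ∀ t : LinearMap.ker ε, ∀ j, t.1.1 (0, j) = 0 := by
    intro t j
    by_cases hj : (j : ℕ) = 0
    · have h0 : ε t.1 = 0 := t.2
      rw [show j = ⟨0, hm⟩ from Fin.ext hj]
      exact h0
    · have h1 := congrArg (· ᵥ* Cᵀ) (hmem t.1)
      simp only [Matrix.add_vecMul, Matrix.vecMul_vecMul, ← h, Matrix.zero_vecMul] at h1
      have h2 := congrFun h1 j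
      simpa [splitState, Matrix.vecMul_diagonal, hj] using h2
  let κ : LinearMap.ker ε →ₗ[ℂ] LinearMap.ker (slice χ 1).vecMulLinear :=
    LinearMap.codRestrict _
      (LinearMap.funLeft ℂ ℂ (fun j => ((1 : Fin 2), j)) ∘ₗ T.subtype ∘ₗ Submodule.subtype _)
      (fun t => by
        have h1 := hmem t.1
        have h2 : (fun j => t.1.1 (0, j)) = 0 := funext (hzero t)
        rw [h2, Matrix.zero_vecMul, zero_add] at h1
        exact h1)
  have hκ : Function.Injective κ := by
    rw [injective_iff_map_eq_zero]
    intro t ht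
    apply Subtype.ext
    apply Subtype.ext
    funext ⟨i, j⟩
    fin_cases i
    · exact hzero t j
    · exact congrFun (congrArg Subtype.val ht) j
  have := LinearMap.finrank_le_finrank_of_injective hκ
  omega

theorem IsCommonResource.le_rank_flattenC {m r : ℕ} (hm : 2 ≤ m) {ψ : TripartiteVec 2 m r}
    (h : IsCommonResource ψ (trulyEntangledStates 2 m m)) : 2 * m ≤ (flattenC ψ).rank + 2 := by
  obtain ⟨A, B, C, h1⟩ := h.2 _ (splitState_mem hm)
  obtain ⟨A', B', C', h2⟩ := h.2 _ (distinctState_mem hm)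
  obtain ⟨hA, hB⟩ := vecMul_injective_of_transform h1 (splitState_mem hm)
  obtain ⟨hA', -⟩ := vecMul_injective_of_transform h2 (distinctState_mem hm)
  rw [Matrix.vecMul_injective_iff_isUnit] at hB
  have hAs : Function.Surjective A'.vecMul := LinearMap.surjective_of_injective (f := A'.vecMulLinear) hA'
  -- The member of the pencil of `ψ` picked out by `A 1` is sent to a nonzero member of the pencil
  -- of `distinctState`, so its rank is at least `m - 1`.
  obtain ⟨f, hf⟩ := hAs (A 1)
  have hf0 : f ≠ 0 := by
    rintro rfl
    have h0 : A 1 = 0 := by rw [← hf]; simp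
    have : (Pi.single 1 1 : Fin 2 → ℂ) = 0 := hA (by
      change Pi.single 1 1 ᵥ* A = 0 ᵥ* A
      simp [Matrix.row, h0])
    simpa using congrFun this 1
  -- Only `A` and `B` are applied to `ψ`, leaving `C` as the remaining step to `splitState`.
  have hχ := rank_slice_one_le_of_splitState (((A ⊗ₖ B) ⊗ₖ (1 : Matrix (Fin r) (Fin r) ℂ)) *ᵥ ψ) C
    (fun i => by rw [slice_of_transform h1, slice_kronecker_mulVec]; simp)
  rw [flattenC_kronecker_mulVec, slice_kronecker_mulVec] at hχ
  simp only [Matrix.transpose_one, Matrix.mul_one] at hχ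
  rw [Matrix.rank_mul_eq_right_of_isUnit_det B _ ((Matrix.isUnit_iff_isUnit_det B).1 hB)] at hχ
  have h3 := le_rank_combination_distinctState (m := m) f hf0
  rw [combination_of_transform h2, show f ᵥ* A' = A 1 from hf] at h3
  have h4 := (Matrix.rank_mul_le_left (B' * ∑ l, A 1 l • slice ψ l) C'ᵀ).trans
    (Matrix.rank_mul_le_right B' _)
  have h5 := Matrix.rank_mul_le_right (A ⊗ₖ B) (flattenC ψ)
  omega

theorem not_isCommonResource_of_le {m a b c : ℕ} (hm : 2 ≤ m) (ha : a ≤ 2) (hb : b ≤ m)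
    (hc : c ≤ 2 * m - 3) (ψ : TripartiteVec a b c) :
    ¬ IsCommonResource ψ (trulyEntangledStates 2 m m) := by
  intro h
  obtain ⟨A, B, C, h1⟩ := h.2 _ (splitState_mem hm)
  obtain ⟨hA, hB⟩ := vecMul_injective_of_transform h1 (splitState_mem hm)
  have hA' := LinearMap.finrank_le_finrank_of_injective (f := A.vecMulLinear) hA
  have hB' := LinearMap.finrank_le_finrank_of_injective (f := B.vecMulLinear) hB
  rw [Module.finrank_fin_fun, Module.finrank_fin_fun] at hA' hB'
  obtain rfl : a = 2 := le_antisymm ha hA'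
  obtain rfl : b = m := le_antisymm hb hB'
  have h2 := h.le_rank_flattenC hm
  have h3 := (flattenC ψ).rank_le_card_width
  rw [Fintype.card_fin] at h3
  omega

/-! ### Reaching every `2 × m × m` state from the resource -/

/-- The transpose of the third-party operator producing the pencil `μ R + λ S` from the resource. -/
def resourceColumns {m : ℕ} (R S : Matrix (Fin m) (Fin m) ℂ) :
    Matrix (Fin (2 * m - 2)) (Fin m) ℂ :=
  Matrix.of fun (j : Fin (2 * m - 2)) k =>
    have := j.2
    -- Columns `2i` and `2i + 1` carry the `λ`- and `μ`-rows of index `i`, except the last two,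
    -- which carry the `μ`-row of `m - 2` and the `λ`-row of `m - 1`. Column `2m - 5` is shared
    -- inside `L₂` and also serves the `λ`-row of `m - 2`.
    if (j : ℕ) % 2 = 0 then
      if (j : ℕ) + 4 = 2 * m then R ⟨m - 2, by omega⟩ k else S ⟨j / 2, by omega⟩ k
    else if (j : ℕ) + 3 = 2 * m then S ⟨m - 1, by omega⟩ k else R ⟨j / 2, by omega⟩ k

theorem sum_ite_mul_of_unique {ι : Type*} [Fintype ι] (p : ι → Prop) [DecidablePred p] (x : ι → ℂ)
    (j : ι) (h : ∀ l, p l ↔ l = j) : ∑ l, (if p l then 1 else 0) * x l = x j := by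
  classical
  simp [h]

theorem resourceR_mul_resourceColumns {m : ℕ} (hm : 4 ≤ m) (R S : Matrix (Fin m) (Fin m) ℂ)
    (h : R ⟨m - 1, by omega⟩ = 0) : resourceR m * resourceColumns R S = R := by
  ext i k
  have hi := i.2
  rw [Matrix.mul_apply]
  simp only [resourceR, Matrix.of_apply]
  rcases lt_trichotomy ((i : ℕ) + 2) m with h1 | h1 | h1
  · rw [sum_ite_mul_of_unique _ _ (⟨2 * i + 1, by omega⟩ : Fin (2 * m - 2))]
    · have e : (2 * (i : ℕ) + 1) / 2 = i := by omega
      have e1 : (2 * (i : ℕ) + 1) % 2 ≠ 0 := by omega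
      have e2 : ¬ (2 * (i : ℕ) + 1 + 3 = 2 * m) := by omega
      simp only [resourceColumns, Matrix.of_apply, if_neg e1, if_neg e2, e]
    · intro l
      rw [Fin.ext_iff]
      constructor
      · rintro (h | h)
        · exact h.2
        · omega
      · intro h
        exact Or.inl ⟨by omega, h⟩
  · rw [sum_ite_mul_of_unique _ _ (⟨2 * i, by omega⟩ : Fin (2 * m - 2))]
    · have e1 : (2 * (i : ℕ)) % 2 = 0 := by omega
      have e2 : 2 * (i : ℕ) + 4 = 2 * m := by omega
      simp only [resourceColumns, Matrix.of_apply, if_pos e1, if_pos e2]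
      congr 1
      exact Fin.ext (by simp; omega)
    · intro l
      rw [Fin.ext_iff]
      constructor
      · rintro (h | h)
        · omega
        · exact h.2
      · intro h
        exact Or.inr ⟨h1, h⟩
  · have e : i = ⟨m - 1, by omega⟩ := Fin.ext (by simp; omega)
    rw [e, h, Pi.zero_apply]
    refine Finset.sum_eq_zero fun l _ => ?_
    rw [if_neg, zero_mul]
    simp only
    omega

theorem resourceS_mul_resourceColumns {m : ℕ} (hm : 4 ≤ m) (R S : Matrix (Fin m) (Fin m) ℂ)
    (h : R ⟨m - 3, by omega⟩ = S ⟨m - 2, by omega⟩) : resourceS m * resourceColumns R S = S := by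
  ext i k
  have hi := i.2
  rw [Matrix.mul_apply]
  simp only [resourceS, Matrix.of_apply]
  by_cases h1 : (i : ℕ) + 3 ≤ m
  · rw [sum_ite_mul_of_unique _ _ (⟨2 * i, by omega⟩ : Fin (2 * m - 2))]
    · have e : (2 * (i : ℕ)) / 2 = i := by omega
      have e1 : (2 * (i : ℕ)) % 2 = 0 := by omega
      have e2 : ¬ (2 * (i : ℕ) + 4 = 2 * m) := by omega
      simp only [resourceColumns, Matrix.of_apply, if_pos e1, if_neg e2, e]
    · intro l
      rw [Fin.ext_iff]
      constructor
      · rintro (h | h)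
        · exact h.2
        · omega
      · intro h
        exact Or.inl ⟨h1, h⟩
  · rw [sum_ite_mul_of_unique _ _ (⟨2 * i - 1, by omega⟩ : Fin (2 * m - 2))]
    · have e1 : (2 * (i : ℕ) - 1) % 2 ≠ 0 := by omega
      by_cases h2 : (i : ℕ) + 2 = m
      · have e2 : ¬ (2 * (i : ℕ) - 1 + 3 = 2 * m) := by omega
        have e : (2 * (i : ℕ) - 1) / 2 = m - 3 := by omega
        simp only [resourceColumns, Matrix.of_apply, if_neg e1, if_neg e2, e, h]
        congr 1
        exact Fin.ext (by simp; omega)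
      · have e2 : 2 * (i : ℕ) - 1 + 3 = 2 * m := by omega
        simp only [resourceColumns, Matrix.of_apply, if_neg e1, if_pos e2]
        congr 1
        exact Fin.ext (by simp; omega)
    · intro l
      rw [Fin.ext_iff]
      simp only
      omega

theorem resourceState_transformable {m : ℕ} (hm : 4 ≤ m) {φ : TripartiteVec 2 m m}
    (hφ : φ ∈ trulyEntangledStates 2 m m) : SLOCCTransformable (resourceState m) φ := by
  obtain ⟨-, hA, hB, -⟩ := (mem_trulyEntangledStates_iff φ).1 hφ
  set R := slice φ 0 with hR
  set S := slice φ 1 with hS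
  obtain ⟨p, q, r, s, hd, u, v, w, hli, hw, huv⟩ :=
    exists_combinations_linearIndependent_triple R.vecMulLinear S.vecMulLinear
      (by rwa [Module.finrank_fin_fun])
      (fun x h0 h1 => hB x (Fin.forall_fin_two.2 ⟨h0, h1⟩))
      (fun a b hab => by
        have h0 : a • R + b • S = 0 := by
          refine Matrix.ext_of_single_vecMul fun i => ?_
          have := LinearMap.congr_fun hab (Pi.single i 1)
          simpa [Matrix.vecMul_add, Matrix.vecMul_smul] using this
        have := hA ![a, b] (by rw [Fin.sum_univ_two]; exact h0)
        exact ⟨congrFun this 0, congrFun this 1⟩)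
  set R' := p • R + q • S with hR'
  set S' := r • R + s • S with hS'
  replace hw : w ᵥ* R' = 0 := by simpa [hR', Matrix.vecMul_add, Matrix.vecMul_smul] using hw
  replace huv : u ᵥ* R' + v ᵥ* S' = 0 := by
    simpa [hR', hS', Matrix.vecMul_add, Matrix.vecMul_smul] using huv
  obtain ⟨n, rfl⟩ : ∃ n, m = n + 3 := ⟨m - 3, by omega⟩
  -- The sign turns `u R' + v S' = 0` into the equality of rows imposed by `L₂`.
  have hli' : LinearIndependent ℂ ![u, -v, w] := by
    have e : ![u, -v, w] = (![1, -1, 1] : Fin 3 → ℂˣ) • ![u, v, w] := by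
      funext i
      fin_cases i <;> simp
    rw [e]
    exact hli.units_smul _
  obtain ⟨G, hG, hrow⟩ := hli'.exists_isUnit_matrix
  have g0 : G ⟨n, by omega⟩ = u := hrow 0
  have g1 : G ⟨n + 1, by omega⟩ = -v := hrow 1
  have g2 : G ⟨n + 2, by omega⟩ = w := hrow 2
  have e1 := resourceR_mul_resourceColumns hm (G * R') (G * S') (by
    rw [Matrix.mul_apply_eq_vecMul]
    exact (congrArg (· ᵥ* R') g2).trans hw)
  have e2 := resourceS_mul_resourceColumns hm (G * R') (G * S') (by
    rw [Matrix.mul_apply_eq_vecMul, Matrix.mul_apply_eq_vecMul]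
    refine (congrArg (· ᵥ* R') g0).trans (Eq.trans ?_ (congrArg (· ᵥ* S') g1).symm)
    simp only [Matrix.neg_vecMul]
    exact eq_neg_of_add_eq_zero_left huv)
  set Ct := resourceColumns (G * R') (G * S')
  have hGdet := (Matrix.isUnit_iff_isUnit_det G).1 hG
  have f1 : G⁻¹ * resourceR (n + 3) * Ct = R' := by
    rw [Matrix.mul_assoc, e1, Matrix.nonsing_inv_mul_cancel_left G _ hGdet]
  have f2 : G⁻¹ * resourceS (n + 3) * Ct = S' := by
    rw [Matrix.mul_assoc, e2, Matrix.nonsing_inv_mul_cancel_left G _ hGdet]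
  -- The first operator is the inverse of the change of pencil basis from `R`, `S` to `R'`, `S'`.
  refine ⟨(p * s - q * r)⁻¹ • !![s, -q; -r, p], G⁻¹, Ctᵀ, ext_slice fun i => ?_⟩
  rw [slice_kronecker_mulVec, Fin.sum_univ_two, resourceState, slice_pencilState_zero,
    slice_pencilState_one, Matrix.transpose_transpose, Matrix.mul_add, Matrix.add_mul,
    Matrix.mul_smul, Matrix.mul_smul, Matrix.smul_mul, Matrix.smul_mul, f1, f2]
  fin_cases i
  · calc _ = (p * s - q * r)⁻¹ • (s • R' - q • S') := by simp; module
      _ = (p * s - q * r)⁻¹ • (p * s - q * r) • R := by rw [hR', hS']; congr 1; module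
      _ = _ := by rw [smul_smul, inv_mul_cancel₀ hd, one_smul]; rfl
  · calc _ = (p * s - q * r)⁻¹ • (p • S' - r • R') := by simp; module
      _ = (p * s - q * r)⁻¹ • (p * s - q * r) • S := by rw [hR', hS']; congr 1; module
      _ = _ := by rw [smul_smul, inv_mul_cancel₀ hd, one_smul]; rfl

theorem resourceState_isCommonResource {m : ℕ} (hm : 4 ≤ m) :
    IsCommonResource (resourceState m) (trulyEntangledStates 2 m m) :=
  ⟨(resourceState_transformable hm (splitState_mem (by omega))).ne_zero
    (splitState_mem (by omega)).1, fun _ => resourceState_transformable hm⟩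

/-! ### Optimality -/

/-- A `2 × m × (2m - 2)` vector can be recovered from every common resource it can be transformed
into. -/
theorem IsCommonResource.transformable_of_transformable {m p q r : ℕ} (hm : 2 ≤ m)
    {ψ : TripartiteVec 2 m (2 * m - 2)} {φ : TripartiteVec p q r}
    (hφ : IsCommonResource φ (trulyEntangledStates 2 m m)) (h : SLOCCTransformable ψ φ) :
    SLOCCTransformable φ ψ := by
  obtain ⟨A, B, C, h⟩ := h
  obtain ⟨A', B', C', h'⟩ := hφ.2 _ (splitState_mem hm)
  have hcomp : (((A' * A) ⊗ₖ (B' * B)) ⊗ₖ (C' * C)) *ᵥ ψ = splitState m := by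
    rw [Matrix.mul_kronecker_mul, Matrix.mul_kronecker_mul, ← Matrix.mulVec_mulVec, h, h']
  obtain ⟨hA, hB⟩ := vecMul_injective_of_transform hcomp (splitState_mem hm)
  rw [Matrix.vecMul_injective_iff_isUnit, Matrix.isUnit_iff_isUnit_det] at hA hB
  -- Applying `C` alone already gives a common resource in `2 × m × r`, so the rank bound forces `C`
  -- to have full column rank.
  have hχ : SLOCCTransformable
      ((((1 : Matrix (Fin 2) (Fin 2) ℂ) ⊗ₖ (1 : Matrix (Fin m) (Fin m) ℂ)) ⊗ₖ C) *ᵥ ψ) φ :=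
    ⟨A, B, 1, by
      rw [Matrix.mulVec_mulVec, ← Matrix.mul_kronecker_mul, ← Matrix.mul_kronecker_mul,
        Matrix.mul_one, Matrix.mul_one, Matrix.one_mul, h]⟩
  have hrank := IsCommonResource.le_rank_flattenC hm
    (ψ := (((1 : Matrix (Fin 2) (Fin 2) ℂ) ⊗ₖ (1 : Matrix (Fin m) (Fin m) ℂ)) ⊗ₖ C) *ᵥ ψ)
    ⟨hχ.ne_zero hφ.1, fun χ hχ' => hχ.trans (hφ.2 χ hχ')⟩
  rw [flattenC_kronecker_mulVec] at hrank
  have h1 := Matrix.rank_mul_le_right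
    (((1 : Matrix (Fin 2) (Fin 2) ℂ) ⊗ₖ (1 : Matrix (Fin m) (Fin m) ℂ)) * flattenC ψ) Cᵀ
  rw [Matrix.rank_transpose] at h1
  have h2 := C.rank_le_width
  obtain ⟨D, hD⟩ := C.exists_left_inverse_of_rank_eq (by omega)
  -- `A` and `B` need not be square, but the return to `splitState` makes `A' * A` and `B' * B`
  -- invertible, which gives left inverses.
  refine ⟨(A' * A)⁻¹ * A', (B' * B)⁻¹ * B', D, ?_⟩
  rw [← h, Matrix.mulVec_mulVec, ← Matrix.mul_kronecker_mul, ← Matrix.mul_kronecker_mul,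
    Matrix.mul_assoc, Matrix.mul_assoc, Matrix.nonsing_inv_mul _ hA, Matrix.nonsing_inv_mul _ hB, hD]
  simp

theorem theorem6 (m : ℕ) (hm : 4 ≤ m) :
    IsOptimalCommonResource (resourceState m) (trulyEntangledStates 2 m m) ∧
      ∀ (a b c : ℕ), a ≤ 2 → b ≤ m → c ≤ 2 * m - 3 →
        ∀ ψ : TripartiteVec a b c, ¬ IsCommonResource ψ (trulyEntangledStates 2 m m) := by
  refine ⟨⟨resourceState_isCommonResource hm, fun p q r φ hφ => ?_⟩,
    fun a b c ha hb hc => not_isCommonResource_of_le (by omega) ha hb hc⟩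
  by_cases h : SLOCCTransformable φ (resourceState m)
  · exact Or.inl h
  · exact Or.inr ⟨h, fun h' => h (hφ.transformable_of_transformable (by omega) h')⟩
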